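/- **Definitions.** A *vocabulary* $\tau$ consists of a unary predicate $P$, a binary predicate $<$ and finitely many function symbols $F$, each of some arity $\mathrm{arity}(F)\ge 1$, among them a unary symbol $\mathrm{id}$. It *has arity* $t$ if $t$ is the largest arity of its function symbols, and it is *$t$-canonical* if its function symbols are $F_1,\dots,F_t$ with $\mathrm{arity}(F_s)=s$. A *full index model* (fim) for $\tau$ is a finite set $M$ with a non-empty subset $P^M$, a strict linear order $<^M$ of $P^M$, and for each $F\in\tau$ a symmetric function $F^M:(P^M)^{\mathrm{arity}(F)}\to M$, such that: $\mathrm{id}^M$ is the identity of $P^M$; if $F^M(a_1,\dots,a_r)=G^M(b_1,\dots,b_s)$ with both tuples nondecreasing, then $F=G$ and $a_i=b_i$ for all $i$; and every $b\in M\setminus P^M$ has the form $F^M(a_1,\dots,a_r)$. The unique $F$ with $b$ in the range of $F^M$ is denoted $F_{M,b}$. The *dimension* of $M$ is $|P^M|\ge 1$. A set $B\subseteq M$ is *closed* if $F^M(a_1,\dots,a_r)\in B \iff a_1,\dots,a_r\in B$ always holds; $\mathrm{cl}_M(A)$ is the least closed set including $A$. For a finite non-empty alphabet $\Lambda$, let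 $V=\mathrm{Space}_\Lambda(M)$ be the set of functions $M\to\Lambda$. A set $L\subseteq V$ is a *$V$-line* if there is $N\subseteq M$ with $N\cap P^M\neq\emptyset$ and $N=\mathrm{cl}_M(N\cap P^M)$ such that all members of $L$ agree on $M\setminus N$; for each $\eta\in L$ there is a function $p:\tau\to\Lambda$ (on the function symbols of $\tau$) with $\eta(b)=p(F_{M,b})$ for all $b\in N$; and each function $p:\tau\to\Lambda$ arises in this way from some $\eta\in L$. A *$c$-colouring* is a function into a set of $c$ elements. Let $f^1_\tau(\Lambda,c)$ be the least $k\ge1$ such that for every $\tau$-fim $M$ of dimension $k$ and every $c$-colouring $d$ of $\mathrm{Space}_\Lambda(M)$ there is a line on which $d$ is constant ($\infty$ if there is no such $k$). **Theorem.** Let $\Lambda$ be a finite non-empty set and $c$ a natural number. (1) Let $\tau$ be a $t$-canonical vocabulary. Then $k=f^1_\tau(\Lambda,c)$ is finite, and the following holds. Let $R$ be a ring (with $1$, not necessarily commutative), $r_1,\dots,r_k\in R$, and for $\alpha\in\Lambda$ let $\mathbf p_\alpha(x)=\sum_i a_{\alpha,i}x^i$ be a polynomial over $R$ of degree at most $t$,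 where the constant term $\mathbf p_\alpha(0)$ is the same for all $\alpha\in\Lambda$ (for example, $0$). Then there is a finite set $S\subseteq R$ such that for every $c$-colouring $d$ of $R$ there are $y,z\in R$ and a non-empty $w\subseteq\{1,\dots,k\}$ such that $z=\sum_{\ell\in w}r_\ell$, the set $\{y+\mathbf p_\alpha(z):\alpha\in\Lambda\}$ is included in $S$, and $d$ is constant on it. (2) Let $\tau$ be a vocabulary of arity $t$ which has, for each $s=1,\dots,t$, exactly $m^*$ function symbols of arity $s$. Then $k=f^1_\tau(\Lambda,c)$ is finite, and the following holds. Let $R$ be a ring (with $1$, not necessarily commutative), $r_1,\dots,r_k\in R$, and for $\alpha\in\Lambda$ and $m<m^*$ let $\mathbf p_{\alpha,m}(x)$ be a polynomial over $R$ of degree at most $t$, where for each $m$ the constant term $\mathbf p_{\alpha,m}(0)$ is the same for all $\alpha\in\Lambda$. Then there is a finite set $S\subseteq R^{m^*}$ such that for every $c$-colouring $d$ of $R^{m^*}$ there are $\bar y=\langle y_m:m<m^*\rangle\in R^{m^*}$, $z\in R$ and a non-empty $w\subseteq\{1,\dots,k\}$ such that $z=\sum_{\ell\in w}r_\ell$,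 the set $\{\langle y_m+\mathbf p_{\alpha,m}(z):m<m^*\rangle:\alpha\in\Lambda\}$ is included in $S$, and $d$ is constant on it. -/

import Mathlib

universe u v w

/-- A vocabulary for index models: the (always present) predicates `P` and `<`, together with
finitely many function symbols of positive arity, among them the unary symbol `id`. -/
structure Vocabulary where
  /-- the function symbols -/
  Sym : Type u
  finite_sym : Finite Sym
  arity : Sym → ℕ
  arity_pos : ∀ F, 1 ≤ arity F
  /-- the symbol interpreted as the identity of `P` -/
  idSym : Sym
  arity_idSym : arity idSym = 1

namespace Vocabulary

/-- The arity of the vocabulary, i.e. the largest arity of its function symbols, is `t`. -/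
def HasArity (τ : Vocabulary.{u}) (t : ℕ) : Prop :=
  IsGreatest (Set.range τ.arity) t

/-- `τ` is `t`-canonical: its function symbols are `F_1, …, F_t`, where `F_s` is `s`-place. -/
def IsCanonical (τ : Vocabulary.{u}) (t : ℕ) : Prop :=
  Set.BijOn τ.arity Set.univ (Set.Icc 1 t)

end Vocabulary

/-- A full index model (fim) for the vocabulary `τ`. The function `F^M` is defined exactly on the
tuples from `P^M`, so it is given as a total function on these tuples. (All fims are finite, so
taking the universe of the model in `Type` is no restriction up to isomorphism.) -/
structure Fim (τ : Vocabulary.{u}) where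
  /-- the universe of the model -/
  carrier : Type
  finite_carrier : Finite carrier
  P : Set carrier
  P_nonempty : P.Nonempty
  /-- the strict linear order `<^M` of `P^M` -/
  lt : carrier → carrier → Prop
  mem_of_lt : ∀ x y, lt x y → x ∈ P ∧ y ∈ P
  lt_irrefl : ∀ x, ¬ lt x x
  lt_trans : ∀ x y z, lt x y → lt y z → lt x z
  lt_total : ∀ x ∈ P, ∀ y ∈ P, lt x y ∨ x = y ∨ lt y x
  /-- the interpretations `F^M` -/
  interp : (F : τ.Sym) → (Fin (τ.arity F) → P) → carrier
  interp_symm : ∀ (F : τ.Sym) (a : Fin (τ.arity F) → P) (σ : Equiv.Perm (Fin (τ.arity F))),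
    interp F (a ∘ σ) = interp F a
  /-- values at nondecreasing tuples determine both the function symbol and the tuple -/
  interp_inj : ∀ (F G : τ.Sym) (a : Fin (τ.arity F) → P) (b : Fin (τ.arity G) → P),
    (∀ i j, i < j → lt (a i) (a j) ∨ a i = a j) →
    (∀ i j, i < j → lt (b i) (b j) ∨ b i = b j) →
    interp F a = interp G b →
    (⟨F, a⟩ : (F : τ.Sym) × (Fin (τ.arity F) → P)) = ⟨G, b⟩
  exists_interp : ∀ b, b ∉ P → ∃ (F : τ.Sym) (a : Fin (τ.arity F) → P), interp F a = b
  interp_idSym : ∀ (a : Fin (τ.arity τ.idSym) → P) (i : Fin (τ.arity τ.idSym)),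
    interp τ.idSym a = a i

namespace Fim

variable {τ : Vocabulary.{u}}

/-- The dimension of `M`: the number of elements of `P^M`. -/
noncomputable def dim (M : Fim τ) : ℕ := Nat.card M.P

/-- `Sort^M(F)`, the range of `F^M`. -/
def sort (M : Fim τ) (F : τ.Sym) : Set M.carrier := Set.range (M.interp F)

theorem exists_mem_sort (M : Fim τ) (b : M.carrier) : ∃ F : τ.Sym, b ∈ M.sort F := by
  by_cases hb : b ∈ M.P
  · refine ⟨τ.idSym, fun _ => ⟨b, hb⟩, ?_⟩
    exact M.interp_idSym (fun _ => ⟨b, hb⟩) ⟨0, by rw [τ.arity_idSym]; exact Nat.one_pos⟩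
  · obtain ⟨F, a, h⟩ := M.exists_interp b hb
    exact ⟨F, a, h⟩

/-- `F_{M,b}`: the function symbol `F` for which `b` has the form `F^M(a_1, …, a_r)`. -/
noncomputable def sym (M : Fim τ) (b : M.carrier) : τ.Sym :=
  Classical.choose (M.exists_mem_sort b)

/-- `B` is `M`-closed: `F^M(a_1, …, a_r) ∈ B` if and only if `a_1, …, a_r ∈ B`. -/
def IsClosed (M : Fim τ) (B : Set M.carrier) : Prop :=
  ∀ (F : τ.Sym) (a : Fin (τ.arity F) → M.P), M.interp F a ∈ B ↔ ∀ i, (a i : M.carrier) ∈ B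

/-- `cl_M(A)`: the least `M`-closed set that includes `A`. -/
def cl (M : Fim τ) (A : Set M.carrier) : Set M.carrier :=
  ⋂₀ {B | M.IsClosed B ∧ A ⊆ B}

/-- `Space_Λ(M)`: the functions on `M` whose value at each `b` is a letter of the alphabet
belonging to the function symbol `F_{M,b}`. -/
def Space (M : Fim τ) (Λ : τ.Sym → Type v) : Type v :=
  (b : M.carrier) → Λ (M.sym b)

/-- `L` is a `q`-line of `Space_Λ(M)`, where `q` is a set of types, a type being a choice of a
letter of `Λ F` for each function symbol `F`. The set `N` is the support of the line. -/
def IsLine (M : Fim τ) {Λ : τ.Sym → Type v} (q : Set ((F : τ.Sym) → Λ F))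
    (L : Set (M.Space Λ)) : Prop :=
  ∃ N : Set M.carrier,
    (N ∩ M.P).Nonempty ∧
    N = M.cl (N ∩ M.P) ∧
    (∀ η ∈ L, ∀ ν ∈ L, ∀ b, b ∉ N → η b = ν b) ∧
    (∀ η ∈ L, ∃ p ∈ q, ∀ b ∈ N, η b = p (M.sym b)) ∧
    (∀ p ∈ q, ∃ η ∈ L, ∀ b ∈ N, η b = p (M.sym b))

/-- `b ∈ Sort^M(F)` exactly when `F` is the symbol `F_{M,b}`. -/
theorem mem_sort_iff (M : Fim τ) (b : M.carrier) (F : τ.Sym) : b ∈ M.sort F ↔ M.sym b = F := by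
  have hb : b ∈ M.sort (M.sym b) := Classical.choose_spec (M.exists_mem_sort b)
  have key : ∀ (G : τ.Sym), b ∈ M.sort G → ∃ a : Fin (τ.arity G) → M.P,
      (∀ i j, i < j → M.lt (a i) (a j) ∨ a i = a j) ∧ M.interp G a = b := by
    classical
    rintro G ⟨a, ha⟩
    let _ : LinearOrder M.P :=
      { le := fun x y => M.lt x y ∨ x = y
        le_refl := fun x => Or.inr rfl
        le_trans := by
          rintro x y z (h | rfl) (h' | rfl)
          · exact Or.inl (M.lt_trans _ _ _ h h')
          · exact Or.inl h
          · exact Or.inl h'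
          · exact Or.inr rfl
        le_antisymm := by
          rintro x y (h | rfl) (h' | h')
          · exact absurd (M.lt_trans _ _ _ h h') (M.lt_irrefl _)
          · exact h'.symm
          · rfl
          · rfl
        le_total := by
          intro x y
          rcases M.lt_total x x.2 y y.2 with h | h | h
          · exact Or.inl (Or.inl h)
          · exact Or.inl (Or.inr (Subtype.ext h))
          · exact Or.inr (Or.inl h)
        toDecidableLE := Classical.decRel _ }
    refine ⟨a ∘ Tuple.sort a, fun i j hij => ?_, ?_⟩
    · exact Tuple.monotone_sort a hij.le
    · rw [M.interp_symm, ha]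
  constructor
  · intro h
    obtain ⟨a, ha, ha'⟩ := key _ hb
    obtain ⟨a₂, ha₂, ha₂'⟩ := key _ h
    exact congrArg Sigma.fst (M.interp_inj _ _ a a₂ ha ha₂ (ha'.trans ha₂'.symm))
  · rintro rfl
    exact hb

end Fim

/-- `f¹(p, c)`: the least `k ≥ 1` such that for every `τ`-fim `M` of dimension `k` and every
`c`-colouring of `Space_Λ(M)` there is a monochromatic `p`-line; it is `⊤` if there is no such
`k`. (Fims have dimension at least `1`.) -/
noncomputable def fOneOf (τ : Vocabulary.{u}) (Λ : τ.Sym → Type v)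
    (p : Set ((F : τ.Sym) → Λ F)) (c : ℕ) : ℕ∞ :=
  sInf ((fun k : ℕ => (k : ℕ∞)) '' {k : ℕ | 1 ≤ k ∧
    ∀ M : Fim τ, M.dim = k → ∀ d : M.Space Λ → Fin c,
      ∃ L : Set (M.Space Λ), M.IsLine p L ∧ ∀ η ∈ L, ∀ ν ∈ L, d η = d ν})

/-- `f¹_τ(Λ, c)` for a single alphabet `Λ`, used for every function symbol; the lines are those
for the set of all types. -/
noncomputable def fOne (τ : Vocabulary.{u}) (Λ : Type v) (c : ℕ) : ℕ∞ :=
  fOneOf τ (fun _ => Λ) Set.univ c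

/-! Finiteness of f¹ is a polynomial Hales–Jewett theorem. If an element `F(a₁, …, a_r)` of a fim is
read through `F` and the set `{a₁, …, a_r}`, it suffices to colour maps from finite sets to letters
and to rewrite the letters on all nonempty `v ⊆ w`, the new letter depending only on `|v|`.

That theorem (`phj_of_eq_above`) is proved by colour focusing. In `focus_step` a new block `Y` is
joined to `X`; for nonempty `b ⊆ Y` the letters of all sets `a ∪ b` with `a ⊆ X` form one letter of
the larger alphabet `Finset X → Λ`. What a line does to these mixed sets is a `derived` family, so
the theorem for that family makes the colour independent of it. The recursion ends because a
lexicographic `weight` drops.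

For polynomials (`exists_mono_polynomial`), a point of the space is sent to a sum over symbols and
tuples of coefficients times products of the `r_i`, the letter at `F(a)` selecting the polynomial.
On a line with constant letter `α`, tuples inside the support sum to the nonconstant part of
`p_α(z)`, and the other tuples contribute a fixed `y`. -/

namespace SetPoly

/-! ### Set form of the polynomial Hales–Jewett property. -/

/-- Put the letter `p |v|` on every nonempty `v ⊆ w`. -/
noncomputable def ins {X : Type} {Λ : Type u} (η : Finset X → Λ) (w : Finset X) (p : ℕ → Λ) :
    Finset X → Λ := by
  classical exact fun v => if v.Nonempty ∧ v ⊆ w then p v.card else η v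

theorem ins_of {X : Type} {Λ : Type u} (η : Finset X → Λ) {w v : Finset X} (p : ℕ → Λ)
    (hv : v.Nonempty) (h : v ⊆ w) : ins η w p v = p v.card := by
  simp [ins, hv, h]

theorem ins_of_not {X : Type} {Λ : Type u} (η : Finset X → Λ) {w v : Finset X} (p : ℕ → Λ)
    (h : ¬ (v.Nonempty ∧ v ⊆ w)) : ins η w p v = η v := by
  simp only [ins, if_neg h]

theorem ins_empty {X : Type} {Λ : Type u} (η : Finset X → Λ) (p : ℕ → Λ) : ins η ∅ p = η := by
  funext v
  refine ins_of_not _ _ ?_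
  rintro ⟨h, h'⟩
  exact h.ne_empty (Finset.subset_empty.1 h')

theorem ins_eq_self {X : Type} {Λ : Type u} {η : Finset X → Λ} {w : Finset X} {p : ℕ → Λ}
    (h : ∀ v : Finset X, v.Nonempty → v ⊆ w → η v = p v.card) : ins η w p = η := by
  funext v
  by_cases hv : v.Nonempty ∧ v ⊆ w
  · rw [ins_of _ _ hv.1 hv.2, h v hv.1 hv.2]
  · exact ins_of_not _ _ hv

theorem ins_congr {X : Type} {Λ : Type u} (η : Finset X → Λ) (w : Finset X) {p q : ℕ → Λ}
    (h : ∀ i, 1 ≤ i → p i = q i) : ins η w p = ins η w q := by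
  funext v
  by_cases hv : v.Nonempty ∧ v ⊆ w
  · rw [ins_of _ _ hv.1 hv.2, ins_of _ _ hv.1 hv.2, h _ (Finset.card_pos.2 hv.1)]
  · rw [ins_of_not _ _ hv, ins_of_not _ _ hv]

/-- `d` is constant on the points obtained from `η` by putting the members of `A` on `w`. -/
def Mono {X : Type} {Λ C : Type u} (A : Set (ℕ → Λ)) (d : (Finset X → Λ) → C) : Prop :=
  ∃ (η : Finset X → Λ) (w : Finset X), w.Nonempty ∧
    ∀ p ∈ A, ∀ q ∈ A, d (ins η w p) = d (ins η w q)

/-- The polynomial Hales-Jewett property of a family `A` of sequences of letters. -/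
def PHJ {Λ : Type u} (A : Set (ℕ → Λ)) : Prop :=
  ∀ (C : Type u) [Finite C], ∃ X : Type, Finite X ∧ Nonempty X ∧
    ∀ d : (Finset X → Λ) → C, Mono A d

/-! ### Gluing two blocks and colour focusing. -/

/-- A configuration on `X ⊕ Y` seen from `Y`, with its part on `X` given separately. -/
noncomputable def glue {X Y : Type} {Λ : Type u} (ζ : Finset Y → Finset X → Λ)
    (ξ : Finset X → Λ) : Finset (X ⊕ Y) → Λ := by
  classical exact fun v => if v.toRight = ∅ then ξ v.toLeft else ζ v.toRight v.toLeft

/-- The sequence that puts `p` on the sets inside `γ` and beyond, and `o` elsewhere. -/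
noncomputable def mixed {X : Type} {Λ : Type u} (o p : ℕ → Λ) (γ : Finset X) :
    ℕ → Finset X → Λ := by
  classical exact fun s u => if u ⊆ γ then p (s + u.card) else o (s + u.card)

/-- The family of all `mixed` sequences coming from `B`. -/
def derived {Λ : Type u} (X : Type) (o : ℕ → Λ) (B : Set (ℕ → Λ)) : Set (ℕ → Finset X → Λ) :=
  {p' | ∃ p ∈ B, ∃ γ : Finset X, p' = mixed o p γ}

/-- A set `a ∪ b` with `∅ ≠ b ⊆ w` receives `p` when `a ⊆ γ` and keeps `o` otherwise, which is the
definition of `mixed`; sets with `b = ∅` see only the insertion on `X`. -/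
theorem ins_glue {X Y : Type} {Λ : Type u} (ζ : Finset Y → Finset X → Λ) (η : Finset X → Λ)
    (o p : ℕ → Λ) (γ : Finset X) (w : Finset Y) :
    ins (glue (ins ζ w fun s u => o (s + u.card)) η) (γ.disjSum w) p =
      glue (ins ζ w (mixed o p γ)) (ins η γ p) := by
  classical
  funext v
  obtain ⟨a, b, rfl⟩ : ∃ a b, v = Finset.disjSum a b := ⟨_, _, v.toLeft_disjSum_toRight.symm⟩
  have hsub : a.disjSum b ⊆ γ.disjSum w ↔ a ⊆ γ ∧ b ⊆ w := by
    constructor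
    · intro h
      exact ⟨fun x hx => by simpa using h (Finset.inl_mem_disjSum.2 hx),
        fun x hx => by simpa using h (Finset.inr_mem_disjSum.2 hx)⟩
    · rintro ⟨h, h'⟩
      exact Finset.disjSum_mono h h'
  have hne : (a.disjSum b).Nonempty ↔ a.Nonempty ∨ b.Nonempty := by
    simp only [← Finset.card_pos, Finset.card_disjSum]; omega
  simp only [ins, glue, hsub, hne, Finset.toLeft_disjSum, Finset.toRight_disjSum,
    Finset.card_disjSum]
  rcases b.eq_empty_or_nonempty with rfl | hb
  · simp
  · by_cases hw : b ⊆ w <;> by_cases hγ : a ⊆ γ <;> simp [mixed, hb, hb.ne_empty, hw, hγ, add_comm]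

theorem ins_glue_left {X Y : Type} {Λ : Type u} (ζ : Finset Y → Finset X → Λ)
    (η : Finset X → Λ) (p : ℕ → Λ) (γ : Finset X) :
    ins (glue ζ η) (γ.disjSum ∅) p = glue ζ (ins η γ p) := by
  have h := ins_glue (Y := Y) ζ η p p γ ∅
  rwa [ins_empty, ins_empty] at h

/-- `η` is the focus of monochromatic punctured lines of `r` different colours. -/
def Focused {X : Type} {Λ C : Type u} (o : ℕ → Λ) (B : Set (ℕ → Λ))
    (d : (Finset X → Λ) → C) (r : ℕ) : Prop :=
  ∃ (η : Finset X → Λ) (S : Finset C), S.card = r ∧ ∀ x ∈ S, ∃ γ : Finset X, γ.Nonempty ∧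
    (∀ v : Finset X, v.Nonempty → v ⊆ γ → η v = o v.card) ∧ ∀ p ∈ B, d (ins η γ p) = x

/-- A sequence equal to `o` at positive levels yields the focus itself, so a punctured line with the
colour of its focus is a full monochromatic line. -/
theorem mono_of_focus {X : Type} {Λ C : Type u} {o : ℕ → Λ} {A B : Set (ℕ → Λ)}
    (hAB : ∀ p ∈ A, (∀ i, 1 ≤ i → p i = o i) ∨ p ∈ B) {d : (Finset X → Λ) → C}
    {η : Finset X → Λ} {γ : Finset X} (hγ : γ.Nonempty)
    (ho : ∀ v : Finset X, v.Nonempty → v ⊆ γ → η v = o v.card)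
    (hB : ∀ p ∈ B, d (ins η γ p) = d η) : Mono A d := by
  have key : ∀ p ∈ A, d (ins η γ p) = d η := by
    intro p hp
    rcases hAB p hp with h | h
    · rw [ins_congr η γ h, ins_eq_self ho]
    · exact hB p h
  exact ⟨η, γ, hγ, fun p hp q hq => (key p hp).trans (key q hq).symm⟩

theorem mono_glue {X Y : Type} {Λ C : Type u} {A : Set (ℕ → Λ)}
    {d : (Finset (X ⊕ Y) → Λ) → C} (ζ : Finset Y → Finset X → Λ)
    (h : Mono A fun ξ => d (glue ζ ξ)) : Mono A d := by
  obtain ⟨η, w, hw, h⟩ := h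
  obtain ⟨x, hx⟩ := hw
  refine ⟨glue ζ η, w.disjSum ∅, ⟨Sum.inl x, Finset.inl_mem_disjSum.2 hx⟩, fun p hp q hq => ?_⟩
  rw [ins_glue_left, ins_glue_left]
  exact h p hp q hq

theorem focus_step {Λ : Type u} [Finite Λ] {o : ℕ → Λ} {A B : Set (ℕ → Λ)}
    (hAB : ∀ p ∈ A, (∀ i, 1 ≤ i → p i = o i) ∨ p ∈ B) (hne : B.Nonempty)
    (hD : ∀ (X : Type) [Finite X], PHJ (derived X o B)) (C : Type u) [Finite C] (r : ℕ) :
    ∃ X : Type, Finite X ∧ Nonempty X ∧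
      ∀ d : (Finset X → Λ) → C, Mono A d ∨ Focused o B d r := by
  classical
  induction r with
  | zero =>
    exact ⟨Unit, inferInstance, inferInstance,
      fun d => Or.inr ⟨fun v => o v.card, ∅, rfl, by simp⟩⟩
  | succ r ih =>
    obtain ⟨X, hX, ⟨x₀⟩, h₁⟩ := ih
    -- The colour of a configuration on `Y` is the whole induced colouring of configurations on `X`.
    obtain ⟨Y, hY, -, h₂⟩ := hD X ((Finset X → Λ) → C)
    refine ⟨X ⊕ Y, inferInstance, ⟨Sum.inl x₀⟩, fun d => ?_⟩
    obtain ⟨ζ, w, ⟨y₀, hy₀⟩, hw⟩ := h₂ fun ζ ξ => d (glue ζ ξ)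
    obtain ⟨p₀, hp₀⟩ := hne
    set ζ₀ := ins ζ w (mixed o p₀ ∅) with hζ₀
    have hcol : ∀ p ∈ B, ∀ (γ : Finset X) ξ, d (glue (ins ζ w (mixed o p γ)) ξ) =
        d (glue ζ₀ ξ) := fun p hp γ ξ =>
      congrFun (hw _ ⟨p, hp, γ, rfl⟩ _ ⟨p₀, hp₀, ∅, rfl⟩) ξ
    rcases h₁ fun ξ => d (glue ζ₀ ξ) with h | ⟨η, S, hS, h⟩
    · exact Or.inl (mono_glue ζ₀ h)
    by_cases hmem : d (glue ζ₀ η) ∈ S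
    · obtain ⟨γ, hγ, hγo, hγB⟩ := h _ hmem
      exact Or.inl (mono_glue ζ₀ (mono_of_focus hAB hγ hγo hγB))
    have hfoc : ∀ γ : Finset X, (∀ v : Finset X, v.Nonempty → v ⊆ γ → η v = o v.card) →
        ins (glue (ins ζ w fun s u => o (s + u.card)) η) (γ.disjSum w) o =
          glue (ins ζ w fun s u => o (s + u.card)) η := by
      intro γ hγ
      rw [ins_glue, ins_eq_self hγ]
      congr 2
      funext s u
      simp [mixed]
    have hfoc' : ∀ γ : Finset X, (∀ v : Finset X, v.Nonempty → v ⊆ γ → η v = o v.card) →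
        ∀ v : Finset (X ⊕ Y), v.Nonempty → v ⊆ γ.disjSum w →
          glue (ins ζ w fun s u => o (s + u.card)) η v = o v.card := by
      intro γ hγ v hv hvs
      rw [← hfoc γ hγ, ins_of _ _ hv hvs]
    refine Or.inr ⟨glue (ins ζ w fun s u => o (s + u.card)) η, insert (d (glue ζ₀ η)) S,
      by rw [Finset.card_insert_of_notMem hmem, hS], fun x hx => ?_⟩
    have hdn : ∀ γ : Finset X, (γ.disjSum w).Nonempty :=
      fun γ => ⟨Sum.inr y₀, Finset.inr_mem_disjSum.2 hy₀⟩
    -- The new colour comes from the line living on `w` alone; each old line is prolonged from `γ`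
    -- to `γ ∪ w`.
    rcases Finset.mem_insert.1 hx with rfl | hx
    · refine ⟨_, hdn ∅, hfoc' ∅ ?_, fun p hp => ?_⟩
      · intro v hv hv'
        exact absurd (Finset.subset_empty.1 hv') hv.ne_empty
      · rw [ins_glue, hcol p hp, ins_empty]
    · obtain ⟨γ, hγ, hγo, hγB⟩ := h _ hx
      refine ⟨_, hdn γ, hfoc' γ hγo, fun p hp => ?_⟩
      rw [ins_glue, hcol p hp]
      exact hγB p hp

/-- With as many focused colours as there are colours, the colour of the focus is among them. -/
theorem phj_of_derived {Λ : Type u} [Finite Λ] {o : ℕ → Λ} {A B : Set (ℕ → Λ)}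
    (hAB : ∀ p ∈ A, (∀ i, 1 ≤ i → p i = o i) ∨ p ∈ B) (hne : B.Nonempty)
    (hD : ∀ (X : Type) [Finite X], PHJ (derived X o B)) : PHJ A := by
  classical
  intro C _
  cases nonempty_fintype C
  obtain ⟨X, hX, hX', h⟩ := focus_step hAB hne hD C (Fintype.card C)
  refine ⟨X, hX, hX', fun d => (h d).elim id ?_⟩
  rintro ⟨η, S, hS, h⟩
  obtain ⟨γ, hγ, hγo, hγB⟩ := h (d η) (by rw [Finset.eq_univ_of_card S hS]; simp)
  exact mono_of_focus hAB hγ hγo hγB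

/-! ### Induction on the weight. -/

/-- The letters at level `s` of the members of `A` that agree with `o` above `s`. -/
def branch {Λ : Type u} (A : Set (ℕ → Λ)) (o : ℕ → Λ) (s : ℕ) : Set Λ :=
  {x | ∃ p ∈ A, (∀ j, s < j → p j = o j) ∧ p s = x}

theorem toLex_lt_of_le {ι : Type*} [LinearOrder ι] [Finite ι] {f g : ι → ℕ} {i : ι}
    (h : ∀ j < i, f j ≤ g j) (hi : f i < g i) : toLex f < toLex g := by
  by_contra hcon
  rcases (not_lt.1 hcon).lt_or_eq with hlt | heq
  · obtain ⟨k, hk, hk'⟩ := hlt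
    simp only [Pi.toLex_apply] at hk hk'
    rcases lt_trichotomy k i with hki | rfl | hki
    · exact absurd (h k hki) (not_le.2 hk')
    · exact absurd hi hk'.not_gt
    · exact hi.ne' (hk i hki)
  · exact hi.ne' (congrFun (toLex.injective heq) i)

/-- The weight of `A` with respect to `o`: the numbers of letters at the levels `t, …, 1`, in
this order of significance. -/
noncomputable def weight {Λ : Type u} (t : ℕ) (A : Set (ℕ → Λ)) (o : ℕ → Λ) :
    Lex ((Fin t)ᵒᵈ → ℕ) :=
  toLex fun i => (branch A o ((OrderDual.ofDual i : Fin t) + 1)).ncard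

/-- Evaluating at `∅` shows that the underlying `p` agrees with `o` above `i`. At nonempty `u` both
cases of `mixed` therefore give `o`, and only the letter `p i` is free. -/
theorem branch_derived_subset {Λ : Type u} {X : Type} {o p₁ : ℕ → Λ} {B : Set (ℕ → Λ)} {s i : ℕ}
    (hp₁ : ∀ j, s < j → p₁ j = o j) (hi : s ≤ i) :
    branch (derived X o B) (mixed o p₁ ∅) i ⊆
      (fun x u => if u.card = 0 then x else o (i + u.card)) '' branch B o i := by
  classical
  rintro _ ⟨_, ⟨p, hp, γ, rfl⟩, hj, rfl⟩
  have hpo : ∀ j, i < j → p j = o j := by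
    intro j hij
    have := congrFun (hj j hij) ∅
    simpa [mixed, hp₁ j (hi.trans_lt hij)] using this
  refine ⟨p i, ⟨p, hp, hpo, rfl⟩, ?_⟩
  funext u
  rcases u.eq_empty_or_nonempty with rfl | hu
  · simp [mixed]
  · have := hu.card_pos
    simp only [mixed, this.ne', if_false]
    split_ifs
    · rw [hpo _ (by omega)]
    · rfl

/-- After discarding what equals `o` at positive levels, the new base is built from a member whose
top difference with `o`, at level `s`, is lowest. Branches above `s` do not grow and the one at `s`
shrinks; lower ones may grow, hence the lexicographic order. -/
theorem phj_of_eq_above (t : ℕ) (W : Lex ((Fin t)ᵒᵈ → ℕ)) :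
    ∀ (Λ : Type u) [Finite Λ] (A : Set (ℕ → Λ)) (o : ℕ → Λ), o ∈ A →
      (∀ p ∈ A, ∀ j, t < j → p j = o j) → weight t A o = W → PHJ A := by
  classical
  induction W using WellFoundedLT.induction with
  | ind W ih =>
  intro Λ _ A o hoA hA hW
  by_cases hall : ∀ p ∈ A, ∀ i, 1 ≤ i → p i = o i
  · intro C _
    refine ⟨Unit, inferInstance, inferInstance, fun d => ⟨fun v => o v.card, {()}, by simp, ?_⟩⟩
    intro p hp q hq
    rw [ins_congr _ _ (hall p hp), ins_congr _ _ (hall q hq)]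
  set B : Set (ℕ → Λ) := {p ∈ A | ¬ ∀ i, 1 ≤ i → p i = o i} with hB
  have htop : ∀ p ∈ B, ∃ s, 1 ≤ s ∧ p s ≠ o s ∧ ∀ j, s < j → p j = o j := by
    rintro p ⟨hp, hne⟩
    push Not at hne
    obtain ⟨i, hi, hpi⟩ := hne
    have hbd : ∀ j, p j ≠ o j → j ≤ t := fun j hj => by
      by_contra hc
      exact hj (hA p hp j (not_le.1 hc))
    refine ⟨Nat.findGreatest (fun j => p j ≠ o j) t, hi.trans (Nat.le_findGreatest (hbd i hpi) hpi),
      Nat.findGreatest_spec (P := fun j => p j ≠ o j) (hbd i hpi) hpi, fun j hj => ?_⟩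
    by_contra hc
    exact absurd (Nat.le_findGreatest (P := fun j => p j ≠ o j) (hbd j hc) hc) (not_le.2 hj)
  have hBne : B.Nonempty := by
    push Not at hall
    obtain ⟨p, hp, i, hi, h⟩ := hall
    exact ⟨p, hp, fun h' => h (h' i hi)⟩
  have hex : ∃ s, 1 ≤ s ∧ ∃ p ∈ B, p s ≠ o s ∧ ∀ j, s < j → p j = o j := by
    obtain ⟨p, hp⟩ := hBne
    obtain ⟨s, h1, h2, h3⟩ := htop p hp
    exact ⟨s, h1, p, hp, h2, h3⟩
  obtain ⟨hs1, p₁, hp₁B, hp₁s, hp₁⟩ := Nat.find_spec hex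
  have hmin := fun m => Nat.find_min hex (m := m)
  set s := Nat.find hex
  have hst : s ≤ t := by
    by_contra hc
    exact hp₁s (hA p₁ hp₁B.1 s (not_le.1 hc))
  refine phj_of_derived (o := o) (B := B) ?_ hBne ?_
  · intro p hp
    by_cases h : ∀ i, 1 ≤ i → p i = o i
    · exact Or.inl h
    · exact Or.inr ⟨hp, h⟩
  intro X _
  refine ih (weight t (derived X o B) (mixed o p₁ ∅)) ?_ _ _ _ ⟨p₁, hp₁B, ∅, rfl⟩ ?_ rfl
  · rw [← hW]
    have hcard : ∀ i, s ≤ i → (branch (derived X o B) (mixed o p₁ ∅) i).ncard ≤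
        (branch B o i).ncard := fun i hi =>
      (Set.ncard_le_ncard (branch_derived_subset hp₁ hi) (Set.toFinite _)).trans
        (Set.ncard_image_le (Set.toFinite _))
    have hsub : ∀ i, branch B o i ⊆ branch A o i := by
      rintro i _ ⟨p, hp, h, rfl⟩
      exact ⟨p, hp.1, h, rfl⟩
    refine toLex_lt_of_le (i := OrderDual.toDual (⟨s - 1, by omega⟩ : Fin t)) ?_ ?_
    · intro j hj
      have hj' : s - 1 < (OrderDual.ofDual j : Fin t).1 := hj
      exact (hcard _ (by omega)).trans (Set.ncard_le_ncard (hsub _) (Set.toFinite _))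
    · have hs : s - 1 + 1 = s := by omega
      simp only [OrderDual.ofDual_toDual, hs]
      -- The letter `o s` is lost: a member of `B` agreeing with `o` from `s` on would differ last
      -- below `s`, against minimality.
      refine (hcard s le_rfl).trans_lt (Set.ncard_lt_ncard ?_ (Set.toFinite _))
      refine ⟨hsub s, fun hc => ?_⟩
      obtain ⟨p, hp, hpj, hps⟩ := hc ⟨o, hoA, fun _ _ => rfl, rfl⟩
      obtain ⟨s', h1, h2, h3⟩ := htop p hp
      have : s' < s := by
        rcases lt_trichotomy s' s with h | h | h
        · exact h
        · exact absurd (h ▸ hps) h2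
        · exact absurd (hpj s' h) h2
      exact hmin s' this ⟨h1, p, hp, h2, h3⟩
  · rintro _ ⟨p, hp, γ, rfl⟩ j hj
    funext u
    have h1 := hA p hp.1 (j + u.card) (by omega)
    have h2 := hA p₁ hp₁B.1 (j + u.card) (by omega)
    simp only [mixed, h1, h2, ite_self]

end SetPoly

/-! ### Supports of elements of a fim. -/

theorem eq_of_monotone_of_map_eq {n : ℕ} {α : Type*} [LinearOrder α] {f g : Fin n → α}
    (hf : Monotone f) (hg : Monotone g)
    (h : Multiset.map f Finset.univ.val = Multiset.map g Finset.univ.val) : f = g := by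
  rw [← List.ofFn_inj]
  refine List.Perm.eq_of_pairwise' (r := (· ≤ ·)) ?_ ?_ ?_
  · exact List.pairwise_ofFn.2 fun i j hij => hf hij.le
  · exact List.pairwise_ofFn.2 fun i j hij => hg hij.le
  · rw [← Multiset.coe_eq_coe]
    simpa [Fin.univ_val_map] using h

namespace Fim

variable {τ : Vocabulary.{u}} (M : Fim τ)

theorem exists_sorted {n : ℕ} (a : Fin n → M.P) : ∃ σ : Equiv.Perm (Fin n),
    ∀ i j, i < j → M.lt (a (σ i)) (a (σ j)) ∨ a (σ i) = a (σ j) := by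
  classical
  let _ : LinearOrder M.P :=
    { le := fun x y => M.lt x y ∨ x = y
      le_refl := fun x => Or.inr rfl
      le_trans := by
        rintro x y z (h | rfl) (h' | rfl)
        · exact Or.inl (M.lt_trans _ _ _ h h')
        · exact Or.inl h
        · exact Or.inl h'
        · exact Or.inr rfl
      le_antisymm := by
        rintro x y (h | rfl) (h' | h')
        · exact absurd (M.lt_trans _ _ _ h h') (M.lt_irrefl _)
        · exact h'.symm
        · rfl
        · rfl
      le_total := by
        intro x y
        rcases M.lt_total x x.2 y y.2 with h | h | h
        · exact Or.inl (Or.inl h)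
        · exact Or.inl (Or.inr (Subtype.ext h))
        · exact Or.inr (Or.inl h)
      toDecidableLE := Classical.decRel _ }
  exact ⟨Tuple.sort a, fun i j hij => Tuple.monotone_sort a hij.le⟩

/-- Sorting both tuples changes neither values nor ranges and makes `interp_inj` applicable. -/
theorem range_eq_of_interp_eq {F G : τ.Sym} {a : Fin (τ.arity F) → M.P}
    {b : Fin (τ.arity G) → M.P} (h : M.interp F a = M.interp G b) :
    Set.range a = Set.range b := by
  obtain ⟨σ, hσ⟩ := M.exists_sorted a
  obtain ⟨ρ, hρ⟩ := M.exists_sorted b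
  have := M.interp_inj F G (a ∘ σ) (b ∘ ρ) hσ hρ
    (by rw [M.interp_symm, M.interp_symm, h])
  have key : ∀ x y : (F : τ.Sym) × (Fin (τ.arity F) → M.P), x = y →
      Set.range x.2 = Set.range y.2 := by
    rintro x _ rfl
    rfl
  have h2 := key _ _ this
  simpa only [EquivLike.range_comp] using h2

theorem exists_tuple (b : M.carrier) : ∃ a, M.interp (M.sym b) a = b :=
  (M.mem_sort_iff b _).2 rfl

/-- The set of the elements `a₁, …, a_r` of `P` for which `b = F(a₁, …, a_r)`. -/
noncomputable def supp (b : M.carrier) : Finset M.P := by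
  classical exact Finset.univ.image (M.exists_tuple b).choose

theorem coe_supp (b : M.carrier) : (M.supp b : Set M.P) = Set.range (M.exists_tuple b).choose := by
  simp [supp]

theorem coe_supp_interp (F : τ.Sym) (a : Fin (τ.arity F) → M.P) :
    (M.supp (M.interp F a) : Set M.P) = Set.range a := by
  rw [coe_supp]
  exact M.range_eq_of_interp_eq (M.exists_tuple _).choose_spec

theorem supp_nonempty (b : M.carrier) : (M.supp b).Nonempty := by
  rw [← Finset.coe_nonempty, coe_supp]
  have := τ.arity_pos (M.sym b)
  exact ⟨_, ⟨0, this⟩, rfl⟩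

theorem card_supp_le (b : M.carrier) : (M.supp b).card ≤ τ.arity (M.sym b) := by
  classical
  refine Finset.card_image_le.trans ?_
  simp

theorem interp_idSym_const (x : M.P) : M.interp τ.idSym (fun _ => x) = x :=
  M.interp_idSym (fun _ => x) ⟨0, τ.arity_pos _⟩

theorem supp_coe (x : M.P) : M.supp (x : M.carrier) = {x} := by
  rw [← Finset.coe_inj, ← M.interp_idSym_const x, coe_supp_interp]
  have : Nonempty (Fin (τ.arity τ.idSym)) := ⟨0, τ.arity_pos _⟩
  simp

theorem supp_interp_subset {F : τ.Sym} {a : Fin (τ.arity F) → M.P} {w : Finset M.P} :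
    M.supp (M.interp F a) ⊆ w ↔ ∀ i, a i ∈ w := by
  rw [← Finset.coe_subset, coe_supp_interp, Set.range_subset_iff]
  rfl

theorem isClosed_supp_subset (w : Finset M.P) : M.IsClosed {b | M.supp b ⊆ w} := by
  intro F a
  simp only [Set.mem_ofPred_eq, supp_interp_subset, supp_coe, Finset.singleton_subset_iff]

theorem cl_supp_subset (w : Finset M.P) :
    {b | M.supp b ⊆ w} = M.cl ({b | M.supp b ⊆ w} ∩ M.P) := by
  refine Set.Subset.antisymm ?_ ?_
  · rintro b hb B ⟨hB, hsub⟩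
    obtain ⟨a, ha⟩ := M.exists_tuple b
    rw [← ha]
    refine (hB _ _).2 fun i => hsub ⟨?_, (a i).2⟩
    have hb' : M.supp (M.interp (M.sym b) a) ⊆ w := by rw [ha]; exact hb
    simpa [supp_coe] using M.supp_interp_subset.1 hb' i
  · exact Set.sInter_subset_of_mem ⟨M.isClosed_supp_subset w, Set.inter_subset_left⟩

end Fim

instance Fim.finite_space {τ : Vocabulary.{u}} (M : Fim τ) (Λ : Type v) [Finite Λ] :
    Finite (M.Space fun _ => Λ) := by
  have := M.finite_carrier
  unfold Fim.Space
  infer_instance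

/-! ### Finiteness of f¹. -/

/-- Every `c`-colouring of the space of a fim of dimension `k` has a monochromatic line. -/
def HasMonoLine (τ : Vocabulary.{u}) (Λ : Type v) (c k : ℕ) : Prop :=
  ∀ M : Fim τ, M.dim = k → ∀ d : M.Space (fun _ => Λ) → Fin c,
    ∃ L : Set (M.Space fun _ => Λ), M.IsLine Set.univ L ∧ ∀ η ∈ L, ∀ ν ∈ L, d η = d ν

theorem exists_hasMonoLine (τ : Vocabulary.{u}) (Λ : Type v) [Finite Λ] [Nonempty Λ] (c : ℕ) :
    ∃ k, 1 ≤ k ∧ HasMonoLine τ Λ c k := by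
  classical
  have := τ.finite_sym
  obtain ⟨t, ht⟩ : ∃ t, ∀ F, τ.arity F ≤ t := by
    obtain ⟨t, ht⟩ := (Set.finite_range τ.arity).bddAbove
    exact ⟨t, fun F => ht ⟨F, rfl⟩⟩
  let ψ₀ : τ.Sym → Λ := fun _ => Classical.arbitrary Λ
  -- A set carries one letter per symbol. The default `ψ₀` above `t` makes the family eventually
  -- constant; supports have at most `t` elements, so it is never read on the line.
  let s : (τ.Sym → Λ) → ℕ → τ.Sym → Λ := fun ψ j => if j ≤ t then ψ else ψ₀
  have hphj : SetPoly.PHJ (Set.range s) := by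
    refine SetPoly.phj_of_eq_above t _ _ _ (s ψ₀) ⟨_, rfl⟩ ?_ rfl
    rintro _ ⟨ψ, rfl⟩ j hj
    simp [s, hj.not_ge]
  obtain ⟨X, hX, hX', h⟩ := hphj (ULift (Fin c))
  refine ⟨Nat.card X, Nat.card_pos, fun M hM d => ?_⟩
  have := M.finite_carrier
  obtain ⟨e⟩ : Nonempty (X ≃ M.P) := Finite.card_eq.1 hM.symm
  let T : (Finset X → τ.Sym → Λ) → M.Space fun _ => Λ :=
    fun η b => η ((M.supp b).map e.symm.toEmbedding) (M.sym b)
  obtain ⟨η, w, hw, hmono⟩ := h fun η => ULift.up (d (T η))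
  let w' : Finset M.P := w.map e.toEmbedding
  have hsub : ∀ b, (M.supp b).map e.symm.toEmbedding ⊆ w ↔ M.supp b ⊆ w' := by
    intro b
    simp only [w', Finset.subset_iff, Finset.mem_map_equiv, e.symm_symm]
    exact ⟨fun h x hx => h (by simpa using hx), fun h x hx => by simpa using h hx⟩
  have hin : ∀ ψ b, M.supp b ⊆ w' → T (SetPoly.ins η w (s ψ)) b = ψ (M.sym b) := by
    intro ψ b hb
    have hc : (M.supp b).card ≤ t := (M.card_supp_le b).trans (ht _)
    simp only [T]
    rw [SetPoly.ins_of _ _ ((M.supp_nonempty b).map) ((hsub b).2 hb)]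
    simp [s, hc]
  refine ⟨Set.range fun ψ => T (SetPoly.ins η w (s ψ)),
    ⟨{b | M.supp b ⊆ w'}, ?_, M.cl_supp_subset w', ?_, ?_, ?_⟩, ?_⟩
  · obtain ⟨x, hx⟩ := hw
    refine ⟨e x, ?_, (e x).2⟩
    simp [M.supp_coe, w', hx]
  · rintro _ ⟨ψ, rfl⟩ _ ⟨ψ', rfl⟩ b hb
    have : ¬ (M.supp b).map e.symm.toEmbedding ⊆ w := fun h => hb ((hsub b).1 h)
    simp only [T]
    rw [SetPoly.ins_of_not _ _ fun h => this h.2, SetPoly.ins_of_not _ _ fun h => this h.2]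
  · rintro _ ⟨ψ, rfl⟩
    exact ⟨ψ, Set.mem_univ _, fun b hb => hin ψ b hb⟩
  · rintro ψ -
    exact ⟨_, ⟨ψ, rfl⟩, fun b hb => hin ψ b hb⟩
  · rintro _ ⟨ψ, rfl⟩ _ ⟨ψ', rfl⟩
    exact congrArg ULift.down (hmono _ ⟨ψ, rfl⟩ _ ⟨ψ', rfl⟩)

theorem exists_fOne_eq (τ : Vocabulary.{u}) (Λ : Type v) [Finite Λ] [Nonempty Λ] (c : ℕ) :
    ∃ k : ℕ, fOne τ Λ c = k ∧ 1 ≤ k ∧ HasMonoLine τ Λ c k := by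
  obtain ⟨k, hk⟩ := exists_hasMonoLine τ Λ c
  have hne : ((fun k : ℕ => (k : ℕ∞)) '' {k : ℕ | 1 ≤ k ∧ HasMonoLine τ Λ c k}).Nonempty :=
    ⟨_, k, hk, rfl⟩
  obtain ⟨k, hk, hk'⟩ := csInf_mem hne
  exact ⟨k, hk'.symm, hk⟩

theorem sum_list_prod_ofFn {R ι : Type*} [Semiring R] [Fintype ι] (g : ι → R) (n : ℕ) :
    ∑ a : Fin n → ι, (List.ofFn fun i => g (a i)).prod = (∑ i, g i) ^ n := by
  induction n with
  | zero => simp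
  | succ n ih =>
    rw [← (Fin.consEquiv fun _ : Fin (n + 1) => ι).sum_comp, Fintype.sum_prod_type, pow_succ',
      Finset.sum_mul]
    refine Finset.sum_congr rfl fun i _ => ?_
    simp [Fin.consEquiv, List.ofFn_succ, ← Finset.mul_sum, ih]

/-! ### Fims of every dimension. -/

/-- The full index model on the multisets over `Fin k`, labelled by function symbols. -/
noncomputable def Vocabulary.multisetFim (τ : Vocabulary.{u}) {n : ℕ} (e : τ.Sym ≃ Fin n) (k : ℕ)
    (hk : 1 ≤ k) : Fim τ :=
  let pt : Fin k → {x : Fin n × Multiset (Fin k) // x.2.card = τ.arity (e.symm x.1)} :=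
    fun i => ⟨(e τ.idSym, {i}), by simp [τ.arity_idSym]⟩
  have hpt : Function.Injective pt := fun i j h => by simpa [pt] using h
  let idx : Set.range pt ≃ Fin k := (Equiv.ofInjective pt hpt).symm
  have hidx : ∀ x : Set.range pt, pt (idx x) = x := fun x =>
    Equiv.apply_ofInjective_symm hpt x
  have hle : ∀ x y : Set.range pt,
      ((∃ i j, i < j ∧ (x : {x : Fin n × Multiset (Fin k) //
        x.2.card = τ.arity (e.symm x.1)}) = pt i ∧ y = pt j) ∨ x = y) → idx x ≤ idx y := by
    rintro x y (⟨i, j, hij, hx, hy⟩ | rfl)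
    · rw [← hidx x] at hx
      rw [← hidx y] at hy
      rw [hpt hx, hpt hy]
      exact hij.le
    · exact le_rfl
  { carrier := {x : Fin n × Multiset (Fin k) // x.2.card = τ.arity (e.symm x.1)}
    finite_carrier := by
      refine Finite.of_injective
        (β := (F : Fin n) × _root_.Sym (Fin k) (τ.arity (e.symm F))) (fun x => ⟨x.1.1, x.1.2, x.2⟩) ?_
      rintro ⟨⟨F, m⟩, hx⟩ ⟨⟨G, m'⟩, hy⟩ h
      cases h
      rfl
    P := Set.range pt
    P_nonempty := ⟨_, ⟨0, hk⟩, rfl⟩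
    lt := fun x y => ∃ i j, i < j ∧ x = pt i ∧ y = pt j
    mem_of_lt := by
      rintro _ _ ⟨i, j, -, rfl, rfl⟩
      exact ⟨⟨i, rfl⟩, ⟨j, rfl⟩⟩
    lt_irrefl := by
      rintro _ ⟨i, j, hij, rfl, h⟩
      exact hij.ne (hpt h)
    lt_trans := by
      rintro _ _ _ ⟨i, j, hij, rfl, rfl⟩ ⟨i', j', hij', h, rfl⟩
      cases hpt h
      exact ⟨i, j', hij.trans hij', rfl, rfl⟩
    lt_total := by
      rintro _ ⟨i, rfl⟩ _ ⟨j, rfl⟩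
      rcases lt_trichotomy i j with h | rfl | h
      · exact Or.inl ⟨i, j, h, rfl, rfl⟩
      · exact Or.inr (Or.inl rfl)
      · exact Or.inr (Or.inr ⟨j, i, h, rfl, rfl⟩)
    interp := fun F a => ⟨(e F, Finset.univ.val.map fun i => idx (a i)), by simp⟩
    interp_symm := by
      intro F a σ
      refine Subtype.ext (Prod.ext rfl ?_)
      change Multiset.map ((fun i => idx (a i)) ∘ σ) Finset.univ.val = _
      rw [← Multiset.map_map, Multiset.map_univ_val_equiv]
    interp_inj := by
      intro F G a b ha hb h
      have h1 := congrArg (fun x => x.1.1) h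
      obtain rfl : F = G := e.injective h1
      have h2 := congrArg (fun x => x.1.2) h
      have hm : ∀ a : Fin (τ.arity F) → Set.range pt,
          (∀ i j, i < j → (∃ i' j', i' < j' ∧ (a i : {x : Fin n × Multiset (Fin k) //
            x.2.card = τ.arity (e.symm x.1)}) = pt i' ∧ a j = pt j') ∨ a i = a j) →
          Monotone fun i => idx (a i) := by
        intro a ha i j hij
        rcases hij.lt_or_eq with hij | rfl
        · exact hle _ _ (ha i j hij)
        · exact le_rfl
      have h3 := eq_of_monotone_of_map_eq (hm a ha) (hm b hb) h2
      have : a = b := funext fun i => idx.injective (congrFun h3 i)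
      rw [this]
    exists_interp := by
      rintro ⟨⟨F, m⟩, hm⟩ -
      obtain ⟨f, hf⟩ : ∃ f : Fin (τ.arity (e.symm F)) → Fin k,
          Finset.univ.val.map f = m := by
        obtain ⟨l, rfl⟩ := Quot.exists_rep m
        have hl : l.length = τ.arity (e.symm F) := hm
        refine ⟨fun i => l.get (i.cast hl.symm), ?_⟩
        rw [Fin.univ_val_map]
        refine congrArg _ (List.ext_get (by simpa using hl.symm) ?_)
        intro i h1 h2
        simp
      refine ⟨e.symm F, fun i => idx.symm (f i), Subtype.ext (Prod.ext (by simp) ?_)⟩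
      simpa using hf
    interp_idSym := by
      intro a i
      rw [← hidx (a i)]
      refine Subtype.ext (Prod.ext rfl ?_)
      have : ∀ j, j = i := fun j => Fin.ext (by
        have h1 := j.2
        have h2 := i.2
        have h3 := τ.arity_idSym
        omega)
      have hconst : (fun j => idx (a j)) = fun _ => idx (a i) := funext fun j => by rw [this j]
      simp only [hconst, Multiset.map_const', pt]
      simp [τ.arity_idSym] }

/-- Without a fim of dimension `k`, the property defining f¹ could hold vacuously and yield no line.
-/
theorem Vocabulary.exists_fim_dim (τ : Vocabulary.{u}) (k : ℕ) (hk : 1 ≤ k) :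
    ∃ M : Fim τ, M.dim = k := by
  have := τ.finite_sym
  obtain ⟨n, ⟨e⟩⟩ := Finite.exists_equiv_fin τ.Sym
  refine ⟨τ.multisetFim e k hk, ?_⟩
  have hinj : Function.Injective fun i : Fin k =>
      (⟨(e τ.idSym, {i}), by simp [τ.arity_idSym]⟩ :
        {x : Fin n × Multiset (Fin k) // x.2.card = τ.arity (e.symm x.1)}) :=
    fun i j h => by simpa using h
  have := Nat.card_congr (Equiv.ofInjective _ hinj)
  exact this.symm.trans (Nat.card_fin k)

/-! ### From lines to polynomials over rings. -/

namespace Fim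

variable {τ : Vocabulary.{u}} (M : Fim τ)

theorem isClosed_cl (A : Set M.carrier) : M.IsClosed (M.cl A) := by
  intro F a
  constructor
  · intro h i B hB
    exact (hB.1 F a).1 (h B hB) i
  · intro h B hB
    exact (hB.1 F a).2 fun i => h i B hB

end Fim

theorem exists_mono_polynomial (t mStar : ℕ) (τ : Vocabulary.{u}) (Λ : Type v) [Finite Λ]
    [Nonempty Λ] (c : ℕ) (hτ : τ.HasArity t)
    (hm : ∀ s ∈ Set.Icc 1 t, Nat.card {F : τ.Sym // τ.arity F = s} = mStar) (k : ℕ) (hk : 1 ≤ k)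
    (hline : HasMonoLine τ Λ c k) (R : Type w) [Ring R] (r : Fin k → R)
    (p : Λ → Fin mStar → Polynomial R) (hdeg : ∀ α m, (p α m).natDegree ≤ t)
    (hcoeff : ∀ α β m, (p α m).coeff 0 = (p β m).coeff 0) :
    ∃ S : Set (Fin mStar → R), S.Finite ∧
      ∀ d : (Fin mStar → R) → Fin c,
        ∃ (y : Fin mStar → R) (z : R) (W : Finset (Fin k)), W.Nonempty ∧
          z = ∑ l ∈ W, r l ∧
          (∀ α, (fun m => y m + (p α m).eval z) ∈ S) ∧
          (∀ α β, d (fun m => y m + (p α m).eval z) = d (fun m => y m + (p β m).eval z)) := by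
  classical
  have := τ.finite_sym
  cases nonempty_fintype τ.Sym
  have hmem : ∀ F, τ.arity F ∈ Set.Icc 1 t := fun F => ⟨τ.arity_pos F, hτ.2 ⟨F, rfl⟩⟩
  have hequiv : ∀ s : ℕ, s ∈ Set.Icc 1 t → Nonempty ({F : τ.Sym // τ.arity F = s} ≃ Fin mStar) :=
    fun s hs => ⟨Finite.equivFinOfCardEq (hm s hs)⟩
  let e := fun s hs => (hequiv s hs).some
  -- Every coordinate `m` gets exactly one symbol of each arity, hence one for each power of `z`.
  let label : τ.Sym → Fin mStar := fun F => e _ (hmem F) ⟨F, rfl⟩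
  have hlabel : ∀ s hs F (h : τ.arity F = s), label F = e s hs ⟨F, h⟩ := by
    rintro _ hs F rfl
    rfl
  have hsum : ∀ (m : Fin mStar) (f : ℕ → R),
      ∑ F with label F = m, f (τ.arity F) = ∑ s ∈ Finset.Icc 1 t, f s := by
    intro m f
    refine Finset.sum_nbij τ.arity (fun F _ => by simpa using hmem F) ?_ ?_ fun _ _ => rfl
    · intro F hF G hG h
      have hF' : label F = m := by simpa using hF
      have hG' : label G = m := by simpa using hG
      rw [hlabel _ (hmem G) F h, ← hG'] at hF'
      exact congrArg Subtype.val ((e _ (hmem G)).injective hF')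
    · intro s hs
      have hs' : s ∈ Set.Icc 1 t := by simpa using hs
      obtain ⟨⟨F, h⟩, hF⟩ := (e s hs').surjective m
      exact ⟨F, by simpa [hlabel s hs' F h] using hF, h⟩
  have heval : ∀ α m z, (p α m).eval z =
      (p α m).coeff 0 + ∑ s ∈ Finset.Icc 1 t, (p α m).coeff s * z ^ s := by
    intro α m z
    rw [Polynomial.eval_eq_sum_range' (Nat.lt_succ_of_le (hdeg α m)), Finset.sum_range_succ',
      add_comm, Finset.range_eq_Ico, Finset.sum_Ico_add' (fun s => (p α m).coeff s * z ^ s) 0 t 1]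
    simp only [pow_zero, mul_one, zero_add]
    rfl
  obtain ⟨M, hM⟩ := τ.exists_fim_dim k hk
  have := M.finite_carrier
  obtain ⟨g⟩ : Nonempty (Fin k ≃ M.P) := Finite.card_eq.1 (by rw [Nat.card_fin]; exact hM.symm)
  -- All ordered tuples are summed, with products in tuple order, so `(∑ r l) ^ s` expands without
  -- commutativity.
  let term : (M.Space fun _ => Λ) → (m : Fin mStar) → (F : τ.Sym) → (Fin (τ.arity F) → Fin k) → R :=
    fun η m F a => (p (η (M.interp F fun i => g (a i))) m).coeff (τ.arity F) *
      (List.ofFn fun i => r (a i)).prod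
  let T : (M.Space fun _ => Λ) → Fin mStar → R :=
    fun η m => ∑ F with label F = m, ∑ a, term η m F a
  refine ⟨Set.range T, Set.finite_range T, fun d => ?_⟩
  obtain ⟨L, ⟨N, ⟨x, hxN, hxP⟩, hcl, hagree, -, hall⟩, hmono⟩ := hline M hM fun η => d (T η)
  have hclosed : M.IsClosed N := by
    rw [hcl]
    exact M.isClosed_cl _
  choose η hηL hη using fun α : Λ => hall (fun _ => α) (Set.mem_univ _)
  let α₀ : Λ := Classical.arbitrary Λ
  let W : Finset (Fin k) := {l | (g l : M.carrier) ∈ N}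
  -- The constant term is subtracted because `T` involves only positive powers; it does not depend
  -- on `α`.
  let y : Fin mStar → R := fun m => (∑ F with label F = m,
    ∑ a : Fin (τ.arity F) → Fin k with ¬ ∀ i, a i ∈ W, term (η α₀) m F a) - (p α₀ m).coeff 0
  have hin : ∀ α m F, ∑ a : Fin (τ.arity F) → Fin k with ∀ i, a i ∈ W, term (η α) m F a =
      (p α m).coeff (τ.arity F) * (∑ l ∈ W, r l) ^ τ.arity F := by
    intro α m F
    have h0 : ∑ l ∈ W, r l = ∑ l, if l ∈ W then r l else 0 := by simp
    rw [h0, ← sum_list_prod_ofFn, Finset.mul_sum, Finset.sum_filter]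
    refine Finset.sum_congr rfl fun a _ => ?_
    split_ifs with ha
    · have : M.interp F (fun i => g (a i)) ∈ N :=
        (hclosed F _).2 fun i => (Finset.mem_filter.1 (ha i)).2
      simp only [term, hη α _ this, ha, if_true]
    · push Not at ha
      obtain ⟨i, hi⟩ := ha
      rw [List.prod_eq_zero ((List.mem_ofFn' _ _).2 ⟨i, if_neg hi⟩), mul_zero]
  have hout : ∀ α m F, ∑ a : Fin (τ.arity F) → Fin k with ¬ ∀ i, a i ∈ W, term (η α) m F a =
      ∑ a : Fin (τ.arity F) → Fin k with ¬ ∀ i, a i ∈ W, term (η α₀) m F a := by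
    intro α m F
    refine Finset.sum_congr rfl fun a ha => ?_
    have : M.interp F (fun i => g (a i)) ∉ N := fun h =>
      (Finset.mem_filter.1 ha).2 fun i => Finset.mem_filter.2
        ⟨Finset.mem_univ _, (hclosed F _).1 h i⟩
    simp only [term, hagree _ (hηL α) _ (hηL α₀) _ this]
  have key : ∀ α, (fun m => y m + (p α m).eval (∑ l ∈ W, r l)) = T (η α) := by
    intro α
    funext m
    simp only [T, y]
    simp_rw [← Finset.sum_filter_add_sum_filter_not Finset.univ
      (fun a : Fin _ → Fin k => ∀ i, a i ∈ W) (term (η α) m _), hin, hout α]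
    rw [Finset.sum_add_distrib, hsum m fun s => (p α m).coeff s * (∑ l ∈ W, r l) ^ s, heval,
      hcoeff α α₀ m]
    abel
  refine ⟨y, ∑ l ∈ W, r l, W, ⟨g.symm ⟨x, hxP⟩, by simp [W, hxN]⟩, rfl, fun α => ?_, fun α β => ?_⟩
  · rw [key]
    exact ⟨_, rfl⟩
  · rw [key, key]
    exact hmono _ (hηL α) _ (hηL β)

theorem Vocabulary.IsCanonical.hasArity {τ : Vocabulary.{u}} {t : ℕ} (h : τ.IsCanonical t) :
    τ.HasArity t := by
  have ht : 1 ≤ t := (τ.arity_pos τ.idSym).trans (h.mapsTo (Set.mem_univ τ.idSym)).2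
  obtain ⟨F, -, hF⟩ := h.surjOn ⟨ht, le_rfl⟩
  refine ⟨⟨F, hF⟩, ?_⟩
  rintro _ ⟨G, rfl⟩
  exact (h.mapsTo (Set.mem_univ G)).2

theorem Vocabulary.IsCanonical.card_eq_one {τ : Vocabulary.{u}} {t : ℕ} (h : τ.IsCanonical t)
    {s : ℕ} (hs : s ∈ Set.Icc 1 t) : Nat.card {F : τ.Sym // τ.arity F = s} = 1 := by
  obtain ⟨F, -, hF⟩ := h.surjOn hs
  refine Nat.card_eq_one_iff_unique.2 ⟨⟨fun a b => Subtype.ext ?_⟩, ⟨F, hF⟩⟩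
  exact h.injOn (Set.mem_univ _) (Set.mem_univ _) (a.2.trans b.2.symm)

theorem mainTheorem5 :
    (∀ (t : ℕ) (τ : Vocabulary.{u}) (Λ : Type v) [Finite Λ] [Nonempty Λ] (c : ℕ),
      τ.IsCanonical t →
      ∃ k : ℕ, fOne τ Λ c = (k : ℕ∞) ∧
        ∀ (R : Type w) [Ring R] (r : Fin k → R) (p : Λ → Polynomial R),
          (∀ α, (p α).natDegree ≤ t) →
          (∀ α β, (p α).coeff 0 = (p β).coeff 0) →
          ∃ S : Set R, S.Finite ∧
            ∀ d : R → Fin c,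
              ∃ (y z : R) (W : Finset (Fin k)), W.Nonempty ∧ z = ∑ l ∈ W, r l ∧
                (∀ α, y + (p α).eval z ∈ S) ∧
                (∀ α β, d (y + (p α).eval z) = d (y + (p β).eval z))) ∧
    (∀ (t mStar : ℕ) (τ : Vocabulary.{u}) (Λ : Type v) [Finite Λ] [Nonempty Λ] (c : ℕ),
      τ.HasArity t →
      (∀ s ∈ Set.Icc 1 t, Nat.card {F : τ.Sym // τ.arity F = s} = mStar) →
      ∃ k : ℕ, fOne τ Λ c = (k : ℕ∞) ∧
        ∀ (R : Type w) [Ring R] (r : Fin k → R) (p : Λ → Fin mStar → Polynomial R),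
          (∀ α m, (p α m).natDegree ≤ t) →
          (∀ α β m, (p α m).coeff 0 = (p β m).coeff 0) →
          ∃ S : Set (Fin mStar → R), S.Finite ∧
            ∀ d : (Fin mStar → R) → Fin c,
              ∃ (y : Fin mStar → R) (z : R) (W : Finset (Fin k)), W.Nonempty ∧
                z = ∑ l ∈ W, r l ∧
                (∀ α, (fun m => y m + (p α m).eval z) ∈ S) ∧
                (∀ α β, d (fun m => y m + (p α m).eval z) =
                  d (fun m => y m + (p β m).eval z))) := by
  constructor
  · intro t τ Λ _ _ c hτ
    obtain ⟨k, hf, hk, hline⟩ := exists_fOne_eq τ Λ c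
    refine ⟨k, hf, fun R _ r p hdeg hcoeff => ?_⟩
    obtain ⟨S, hS, h⟩ := exists_mono_polynomial t 1 τ Λ c hτ.hasArity
      (fun s hs => hτ.card_eq_one hs) k hk hline R r (fun α _ => p α) (fun α _ => hdeg α)
      (fun α β _ => hcoeff α β)
    refine ⟨(fun f => f 0) '' S, hS.image _, fun d => ?_⟩
    obtain ⟨y, z, W, hW, hz, hmem, hd⟩ := h fun f => d (f 0)
    exact ⟨y 0, z, W, hW, hz, fun α => ⟨_, hmem α, rfl⟩, hd⟩
  · intro t mStar τ Λ _ _ c hτ hm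
    obtain ⟨k, hf, hk, hline⟩ := exists_fOne_eq τ Λ c
    exact ⟨k, hf, fun R _ r p hdeg hcoeff =>
      exists_mono_polynomial t mStar τ Λ c hτ hm k hk hline R r p hdeg hcoeff⟩
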